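/- Let $\mathcal R$ be a non-empty finite signature. The sp-formulas of signature $\mathcal R$ are built from propositional variables $p_0,p_1,\dots$ and $\top$ using $\wedge$ and unary diamonds $\Diamond_R$, $R\in\mathcal R$; an sp-implication is an expression $\sigma\to\tau$ with $\sigma,\tau$ sp-formulas. A *SLO* is a meet-semilattice with greatest element $\top$ and a monotone unary operator $\Diamond_R$ for each $R\in\mathcal R$; it validates $\sigma\to\tau$ if $\sigma\le\tau$ under every valuation of the variables. A (Kripke) frame $\mathfrak F=(W,R^{\mathfrak F})_{R\in\mathcal R}$ is a non-empty set $W$ with binary relations $R^{\mathfrak F}$; it validates $\sigma\to\tau$ if, for every valuation $\mathfrak v(p)\subseteq W$, every $w\in W$ at which $\sigma$ is true makes $\tau$ true (where $\Diamond_R\sigma$ is true at $w$ iff $\sigma$ is true at some $w'$ with $(w,w')\in R^{\mathfrak F}$). The SLO $\mathfrak F^\star$ is $(2^W,\cap,W,\Diamond_R^+)_{R\in\mathcal R}$ with $\Diamond_R^+X=\{w\mid (w,v)\in R^{\mathfrak F}\text{ for some }v\in X\}$. For a set $\Sigma$ of sp-implications, the spi-logic $\mathsf{SPi}+\Sigma$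 is the set of sp-implications derivable from substitution instances of members of $\Sigma$ and of $p\to p$, $p\to\top$, $p\wedge q\to q\wedge p$, $p\wedge q\to p$ by the rules: from $\sigma\to\tau$ and $\tau\to\varrho$ infer $\sigma\to\varrho$; from $\sigma\to\tau$ and $\sigma\to\varrho$ infer $\sigma\to\tau\wedge\varrho$; from $\sigma\to\tau$ infer $\Diamond_R\sigma\to\Diamond_R\tau$. It is *complete* if, for every sp-implication $\iota$ of signature $\mathcal R$, $\iota$ is valid in every frame validating $\Sigma$ iff $\iota$ is valid in every SLO validating $\Sigma$. The logic $L=\mathsf{SPi}+\Sigma$ is *complex* if every SLO validating $L$ has an injective map preserving $\wedge$, $\top$ and all $\Diamond_R$ into $\mathfrak F^\star$ for some frame $\mathfrak F$ validating $L$. **Theorem.** There is no algorithm which, given a non-empty finite signature $\mathcal R$ and a finite set $\Sigma$ of sp-implications of signature $\mathcal R$, decides whether $\mathsf{SPi}+\Sigma$ is complete; nor is there one which decides whether $\mathsf{SPi}+\Sigma$ is complex. Moreover, there is a computable map $M\mapsto\Sigma_M$ from programs (codes of partial recursive functions) to such finite sets (with their signatures) such that $$M\text{ halts on input }0\iff \mathsf{SPi}+\Sigma_M\text{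 is complex}\iff \mathsf{SPi}+\Sigma_M\text{ is complete}.$$ -/

import Mathlib

namespace SPi

/-- Sp-formulas of signature `R`: built from propositional variables (indexed by `ℕ`) and `⊤`
using conjunction and the unary diamonds `◇_r`, for `r : R`. -/
inductive Formula (R : Type) : Type
  | var (p : ℕ) : Formula R
  | top : Formula R
  | and (σ τ : Formula R) : Formula R
  | dia (r : R) (σ : Formula R) : Formula R

/-- Sp-implications `σ → τ` of signature `R`, as pairs (antecedent, consequent). -/
abbrev Implication (R : Type) : Type := Formula R × Formula R

namespace Formula

/-- Uniform substitution of sp-formulas for variables. -/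
def subst {R : Type} (s : ℕ → Formula R) : Formula R → Formula R
  | var p => s p
  | top => top
  | and σ τ => and (σ.subst s) (τ.subst s)
  | dia r σ => dia r (σ.subst s)

/-- Renaming of the diamond symbols along `f`. -/
def rename {R S : Type} (f : R → S) : Formula R → Formula S
  | var p => var p
  | top => top
  | and σ τ => and (σ.rename f) (τ.rename f)
  | dia r σ => dia (f r) (σ.rename f)

end Formula

/-! ### The syntactic calculus and spi-logics -/

/-- `Derives Ax σ τ`: the sp-implication `σ → τ` is derivable from `Ax`. -/
inductive Derives {R : Type} (Ax : Set (Implication R)) : Formula R → Formula R → Prop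
  | ax (ι : Implication R) (h : ι ∈ Ax) (s : ℕ → Formula R) :
      Derives Ax (ι.1.subst s) (ι.2.subst s)
  | refl (σ : Formula R) : Derives Ax σ σ
  | top (σ : Formula R) : Derives Ax σ Formula.top
  | and_comm (σ τ : Formula R) : Derives Ax (σ.and τ) (τ.and σ)
  | and_left (σ τ : Formula R) : Derives Ax (σ.and τ) σ
  | trans {σ τ ρ : Formula R} : Derives Ax σ τ → Derives Ax τ ρ → Derives Ax σ ρ
  | and_intro {σ τ ρ : Formula R} : Derives Ax σ τ → Derives Ax σ ρ → Derives Ax σ (τ.and ρ)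
  | dia_mono (r : R) {σ τ : Formula R} : Derives Ax σ τ → Derives Ax (σ.dia r) (τ.dia r)

/-- The spi-logic `SPi + Ax` axiomatised by `Ax`. -/
def logic {R : Type} (Ax : Set (Implication R)) : Set (Implication R) :=
  {ι | Derives Ax ι.1 ι.2}

/-! ### Algebraic semantics -/

/-- Meet-semilattices (with a greatest element) with monotone operators, of signature `R`. -/
structure SLO (R : Type) where
  carrier : Type
  [semilatticeInf : SemilatticeInf carrier]
  [orderTop : OrderTop carrier]
  dia : R → carrier → carrier
  dia_mono : ∀ r, Monotone (dia r)

attribute [instance] SLO.semilatticeInf SLO.orderTop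

namespace SLO

/-- The value of an sp-formula under a valuation `a` in an SLO. -/
def value {R : Type} (A : SLO R) (a : ℕ → A.carrier) : Formula R → A.carrier
  | Formula.var p => a p
  | Formula.top => ⊤
  | Formula.and σ τ => A.value a σ ⊓ A.value a τ
  | Formula.dia r σ => A.dia r (A.value a σ)

/-- The SLO `A` validates the sp-implication `ι`. -/
def Validates {R : Type} (A : SLO R) (ι : Implication R) : Prop :=
  ∀ a : ℕ → A.carrier, A.value a ι.1 ≤ A.value a ι.2

/-- `A` is embeddable into `B`: there is a one-to-one map preserving `∧`, `⊤` and all `◇_r`. -/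
def Embeddable {R : Type} (A B : SLO R) : Prop :=
  ∃ η : A.carrier → B.carrier, Function.Injective η ∧
    (∀ a b, η (a ⊓ b) = η a ⊓ η b) ∧ η ⊤ = ⊤ ∧ ∀ r a, η (A.dia r a) = B.dia r (η a)

end SLO

/-- Algebraic consequence: every SLO validating `Ax` validates `ι`. -/
def SLOConsequence {R : Type} (Ax : Set (Implication R)) (ι : Implication R) : Prop :=
  ∀ A : SLO R, (∀ κ ∈ Ax, A.Validates κ) → A.Validates ι

/-! ### Kripke semantics -/

/-- Kripke frames of signature `R`. -/
structure Frame (R : Type) where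
  World : Type
  nonempty : Nonempty World
  rel : R → World → World → Prop

namespace Frame

/-- Truth of an sp-formula at a world of the Kripke model `(F, v)`. -/
def Sat {R : Type} (F : Frame R) (v : ℕ → Set F.World) : F.World → Formula R → Prop
  | w, Formula.var p => w ∈ v p
  | _, Formula.top => True
  | w, Formula.and σ τ => F.Sat v w σ ∧ F.Sat v w τ
  | w, Formula.dia r σ => ∃ w', F.rel r w w' ∧ F.Sat v w' σ

/-- The frame `F` validates the sp-implication `ι`. -/
def Validates {R : Type} (F : Frame R) (ι : Implication R) : Prop :=
  ∀ (v : ℕ → Set F.World) (w : F.World), F.Sat v w ι.1 → F.Sat v w ι.2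

/-- The SLO `(2^W, ∩, W, ◇_r⁺)` given by the full complex algebra of the frame `F`. -/
def complexAlgebra {R : Type} (F : Frame R) : SLO R where
  carrier := Set F.World
  dia := fun r X => {w | ∃ v ∈ X, F.rel r w v}
  dia_mono := fun _ _ _ h _ hw => hw.elim fun v hv => ⟨v, h hv.1, hv.2⟩

end Frame

/-- Kripke consequence: every frame validating `Ax` validates `ι`. -/
def KrConsequence {R : Type} (Ax : Set (Implication R)) (ι : Implication R) : Prop :=
  ∀ F : Frame R, (∀ κ ∈ Ax, F.Validates κ) → F.Validates ι

/-! ### Completeness and complexity -/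

/-- The spi-logic `SPi + Ax` is complete. -/
def IsComplete {R : Type} (Ax : Set (Implication R)) : Prop :=
  ∀ ι : Implication R, KrConsequence Ax ι ↔ SLOConsequence Ax ι

/-- The spi-logic `L = SPi + Ax` is complex: every SLO validating `L` is embeddable into the
complex algebra of some frame for `L`. -/
def IsComplex {R : Type} (Ax : Set (Implication R)) : Prop :=
  ∀ A : SLO R, (∀ κ ∈ logic Ax, A.Validates κ) →
    ∃ F : Frame R, (∀ κ ∈ logic Ax, F.Validates κ) ∧ A.Embeddable F.complexAlgebra

/-! ### Decision problems about finite axiomatisations -/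

/-- A Gödel numbering of the sp-formulas whose diamonds are indexed by natural numbers. -/
def encodeFormula : Formula ℕ → ℕ
  | Formula.top => 0
  | Formula.var p => 3 * p + 1
  | Formula.dia r σ => 3 * Nat.pair r (encodeFormula σ) + 2
  | Formula.and σ τ => 3 * Nat.pair (encodeFormula σ) (encodeFormula τ) + 3

/-- The inverse of `encodeFormula`. -/
def decodeFormula : ℕ → Formula ℕ
  | 0 => Formula.top
  | n + 1 =>
    have h1 : (n / 3).unpair.1 < n + 1 :=
      Nat.lt_succ_of_le ((Nat.unpair_left_le _).trans (Nat.div_le_self _ _))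
    have h2 : (n / 3).unpair.2 < n + 1 :=
      Nat.lt_succ_of_le ((Nat.unpair_right_le _).trans (Nat.div_le_self _ _))
    if n % 3 = 0 then Formula.var (n / 3)
    else if n % 3 = 1 then Formula.dia (n / 3).unpair.1 (decodeFormula (n / 3).unpair.2)
    else Formula.and (decodeFormula (n / 3).unpair.1) (decodeFormula (n / 3).unpair.2)

theorem decode_encodeFormula (σ : Formula ℕ) : decodeFormula (encodeFormula σ) = σ := by
  induction σ with
  | top => simp [encodeFormula, decodeFormula]
  | var p => simp [encodeFormula, decodeFormula]
  | dia r σ ih =>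
    have e1 : ∀ k, (3 * k + 1) % 3 = 1 := by omega
    have e2 : ∀ k, (3 * k + 1) / 3 = k := by omega
    simp [encodeFormula, decodeFormula, e1, e2, ih]
  | and σ τ ih1 ih2 =>
    have e1 : ∀ k, (3 * k + 2) % 3 = 2 := by omega
    have e2 : ∀ k, (3 * k + 2) / 3 = k := by omega
    simp [encodeFormula, decodeFormula, e1, e2, ih1, ih2]

theorem encode_decodeFormula (n : ℕ) : encodeFormula (decodeFormula n) = n := by
  induction n using Nat.strong_induction_on with
  | _ n ih =>
    cases n with
    | zero => simp [encodeFormula, decodeFormula]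
    | succ n =>
      have h1 : (n / 3).unpair.1 < n + 1 :=
        Nat.lt_succ_of_le ((Nat.unpair_left_le _).trans (Nat.div_le_self _ _))
      have h2 : (n / 3).unpair.2 < n + 1 :=
        Nat.lt_succ_of_le ((Nat.unpair_right_le _).trans (Nat.div_le_self _ _))
      rw [decodeFormula]
      split_ifs with h h'
      · simp only [encodeFormula]; omega
      · simp only [encodeFormula, ih _ h2, Nat.pair_unpair]; omega
      · simp only [encodeFormula, ih _ h1, ih _ h2, Nat.pair_unpair]; omega

/-- Through this bijection with `ℕ`, and the standard ones for pairs and lists, Mathlib's notion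
of a computable function applies to formulas, implications and lists of implications. -/
instance : Denumerable (Formula ℕ) :=
  Denumerable.mk' ⟨encodeFormula, decodeFormula, decode_encodeFormula, encode_decodeFormula⟩

/-- A finite axiomatisation: a finite non-empty signature, with symbols `0, …, n`, and a finite set
of sp-implications of that signature, given by a list of its elements. -/
structure FinAx where
  n : ℕ
  axioms : List (Implication (Fin (n + 1)))

namespace FinAx

/-- The set of sp-implications listed by a finite axiomatisation. -/
def toSet (S : FinAx) : Set (Implication (Fin (S.n + 1))) := {ι | ι ∈ S.axioms}

/-- The finite data by which a finite axiomatisation is presented to an algorithm: the number `n`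
and the list of the sp-implications, with each symbol written as a natural number. -/
def data (S : FinAx) : ℕ × List (Implication ℕ) :=
  (S.n, S.axioms.map fun ι => (ι.1.rename Fin.val, ι.2.rename Fin.val))

end FinAx

/-- A property of finite axiomatisations is decidable: some computable function answers correctly
on the data of each of them. -/
def IsDecidable (P : FinAx → Prop) : Prop :=
  ∃ d : ℕ × List (Implication ℕ) → Bool, Computable d ∧ ∀ S : FinAx, d S.data = true ↔ P S

end SPi

namespace SPi

open Turing Turing.ToPartrec

variable {R S : Type}

/-! ### Semantics under renaming and substitution, soundness -/

/-! Configurations of a machine are written as sp-formulas, and `rules` lets each machine step be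
derived as an sp-implication. An extra diamond ◇, indexed by `none`, gets the axioms ◇⊤ → start, ◇p
→ p and p ∧ halted → ◇p.

If the machine halts, every SLO for the axioms has ◇⊤ ≤ start ≤ halted (`value_startF_le`), whence
◇x = x ∧ ◇⊤. This is the operator of a subrelation of the identity. The rules have linear left and
guarded right sides, so they pass to the filter frame (`filterFrame_validates`). Sending x to the
set of filters containing x then embeds the SLO (`isComplex_haltingAxioms`), and complexity implies
completeness.

If it does not halt, the implication p ∧ ◇⊤ → ◇p witnesses incompleteness
(`not_isComplete_haltingAxioms`). In a frame, ◇p → p puts the relation inside the identity, which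
makes the implication valid. In the frame of non-halting configurations, however, start holds at the
root and halted nowhere, so its complex algebra admits the non-relational ◇ that maps the whole set
to {root} and every other set to ∅; this refutes the implication.

Applying this to a universal code, with the program as its input, reduces the halting problem to
both properties. -/

theorem Formula.subst_var (σ : Formula R) : σ.subst Formula.var = σ := by
  induction σ <;> simp_all [Formula.subst]

namespace SLO

theorem value_mono (A : SLO R) {a b : ℕ → A.carrier} (h : ∀ p, a p ≤ b p) (σ : Formula R) :
    A.value a σ ≤ A.value b σ := by
  induction σ with
  | var p => exact h p
  | top => exact le_rfl
  | and σ τ h1 h2 => exact inf_le_inf h1 h2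
  | dia r σ ih => exact A.dia_mono r ih

theorem value_subst (A : SLO R) (a : ℕ → A.carrier) (s : ℕ → Formula R) (σ : Formula R) :
    A.value a (σ.subst s) = A.value (fun p => A.value a (s p)) σ := by
  induction σ <;> simp_all [Formula.subst, value]

theorem Validates.of_derives {A : SLO R} {Ax : Set (Implication R)}
    (h : ∀ κ ∈ Ax, A.Validates κ) {σ τ : Formula R} (d : Derives Ax σ τ) :
    A.Validates (σ, τ) := by
  intro a
  induction d with
  | ax ι hι s => simpa only [value_subst] using h ι hι _
  | refl => exact le_rfl
  | top => exact le_top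
  | and_comm => exact (inf_comm _ _).le
  | and_left => exact inf_le_left
  | trans _ _ h1 h2 => exact h1.trans h2
  | and_intro _ _ h1 h2 => exact le_inf h1 h2
  | dia_mono r _ h => exact A.dia_mono r h

theorem validates_logic_iff {A : SLO R} {Ax : Set (Implication R)} :
    (∀ κ ∈ logic Ax, A.Validates κ) ↔ ∀ κ ∈ Ax, A.Validates κ := by
  refine ⟨fun h κ hκ => h κ ?_, fun h κ hκ => Validates.of_derives h hκ⟩
  simpa [logic, Formula.subst_var] using Derives.ax κ hκ Formula.var

/-- The reduct of an SLO along a map of signatures. -/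
def comap (f : R → S) (A : SLO S) : SLO R where
  carrier := A.carrier
  dia r := A.dia (f r)
  dia_mono r := A.dia_mono (f r)

theorem value_rename (f : R → S) (A : SLO S) (a : ℕ → A.carrier) (σ : Formula R) :
    A.value a (σ.rename f) = (A.comap f).value a σ := by
  induction σ with
  | var p => rfl
  | top => rfl
  | and σ τ h1 h2 => exact congrArg₂ (· ⊓ ·) h1 h2
  | dia r σ ih => exact congrArg (A.dia (f r)) ih

end SLO

/-- Renaming of the diamond symbols in an sp-implication. -/
def renameImp (f : R → S) (ι : Implication R) : Implication S :=
  (ι.1.rename f, ι.2.rename f)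

theorem SLO.validates_renameImp (f : R → S) (A : SLO S) (ι : Implication R) :
    A.Validates (renameImp f ι) ↔ (A.comap f).Validates ι := by
  refine forall_congr' fun a => ?_
  rw [renameImp, value_rename, value_rename]
  rfl

namespace Frame

theorem value_complexAlgebra (F : Frame R) (v : ℕ → Set F.World) (σ : Formula R) :
    F.complexAlgebra.value v σ = {w | F.Sat v w σ} := by
  induction σ with
  | var p => rfl
  | top => rfl
  | and σ τ h1 h2 => exact congrArg₂ (fun X Y : Set F.World => X ∩ Y) h1 h2
  | dia r σ ih =>
    exact (congrArg (F.complexAlgebra.dia r) ih).trans (Set.ext fun w =>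
      ⟨fun ⟨x, hx, hr⟩ => ⟨x, hr, hx⟩, fun ⟨x, hr, hx⟩ => ⟨x, hx, hr⟩⟩)

theorem validates_complexAlgebra (F : Frame R) (ι : Implication R) :
    F.complexAlgebra.Validates ι ↔ F.Validates ι :=
  forall_congr' fun v => iff_of_eq (congrArg₂ (fun X Y : Set F.World => X ⊆ Y)
    (F.value_complexAlgebra v ι.1) (F.value_complexAlgebra v ι.2))

theorem validates_logic_iff {F : Frame R} {Ax : Set (Implication R)} :
    (∀ κ ∈ logic Ax, F.Validates κ) ↔ ∀ κ ∈ Ax, F.Validates κ := by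
  simpa only [validates_complexAlgebra] using
    SLO.validates_logic_iff (A := F.complexAlgebra) (Ax := Ax)

/-- The reduct of a frame along a map of signatures. -/
def comap (f : R → S) (F : Frame S) : Frame R where
  World := F.World
  nonempty := F.nonempty
  rel r := F.rel (f r)

theorem sat_rename (f : R → S) (F : Frame S) (v : ℕ → Set F.World) (w : F.World)
    (σ : Formula R) : F.Sat v w (σ.rename f) ↔ (F.comap f).Sat v w σ := by
  induction σ generalizing w with
  | var p => exact Iff.rfl
  | top => exact Iff.rfl
  | and σ τ h1 h2 => exact and_congr (h1 w) (h2 w)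
  | dia r σ ih => exact exists_congr fun x => and_congr_right' (ih x)

theorem validates_renameImp (f : R → S) (F : Frame S) (ι : Implication R) :
    F.Validates (renameImp f ι) ↔ (F.comap f).Validates ι :=
  forall_congr' fun v => forall_congr' fun w =>
    imp_congr (F.sat_rename f v w ι.1) (F.sat_rename f v w ι.2)

end Frame

/-! ### Embeddings, and why complexity implies completeness -/

theorem SLO.Embeddable.validates {A B : SLO R} (h : A.Embeddable B) {ι : Implication R}
    (hB : B.Validates ι) : A.Validates ι := by
  obtain ⟨η, inj, hinf, htop, hdia⟩ := h
  intro a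
  have key : ∀ σ, η (A.value a σ) = B.value (fun p => η (a p)) σ := by
    intro σ
    induction σ with
    | var p => rfl
    | top => exact htop
    | and σ τ h1 h2 => simp [value, hinf, h1, h2]
    | dia r σ ih => simp [value, hdia, ih]
  have := hB fun p => η (a p)
  rw [← key, ← key, ← inf_eq_left, ← hinf] at this
  exact inf_eq_left.1 (inj this)

theorem isComplex_iff {Ax : Set (Implication R)} : IsComplex Ax ↔
    ∀ A : SLO R, (∀ κ ∈ Ax, A.Validates κ) →
      ∃ F : Frame R, (∀ κ ∈ Ax, F.Validates κ) ∧ A.Embeddable F.complexAlgebra := by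
  simp only [IsComplex, SLO.validates_logic_iff, Frame.validates_logic_iff]

theorem SLOConsequence.krConsequence {Ax : Set (Implication R)} {ι : Implication R}
    (h : SLOConsequence Ax ι) : KrConsequence Ax ι := fun F hF =>
  (F.validates_complexAlgebra ι).1 (h _ fun κ hκ => (F.validates_complexAlgebra κ).2 (hF κ hκ))

theorem IsComplex.isComplete {Ax : Set (Implication R)} (h : IsComplex Ax) : IsComplete Ax := by
  refine fun ι => ⟨fun hK A hA => ?_, SLOConsequence.krConsequence⟩
  obtain ⟨F, hF, hAF⟩ := isComplex_iff.1 h A hA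
  exact hAF.validates ((F.validates_complexAlgebra ι).2 (hK F hF))

/-! ### Transfer along a bijection of signatures -/

theorem SLO.validates_comap_renameImp (e : R ≃ S) (A : SLO R) (ι : Implication R) :
    (A.comap e.symm).Validates (renameImp e ι) ↔ A.Validates ι := by
  rw [validates_renameImp]
  have : (A.comap e.symm).comap e = A := by
    cases A; simp [comap]
  rw [this]

theorem IsComplex.renameImp (e : R ≃ S) {Ax : Set (Implication R)} (h : IsComplex Ax) :
    IsComplex (renameImp e '' Ax) := by
  refine isComplex_iff.2 fun A hA => ?_
  obtain ⟨F, hF, η, inj, hinf, htop, hdia⟩ := isComplex_iff.1 h (A.comap e) fun κ hκ =>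
    (SLO.validates_renameImp _ _ _).1 (hA _ ⟨κ, hκ, rfl⟩)
  refine ⟨F.comap e.symm, ?_, η, inj, hinf, htop, fun r a => ?_⟩
  · rintro _ ⟨κ, hκ, rfl⟩
    rw [← Frame.validates_complexAlgebra]
    exact (SLO.validates_comap_renameImp e F.complexAlgebra κ).2
      ((F.validates_complexAlgebra κ).2 (hF κ hκ))
  · obtain ⟨r, rfl⟩ := e.surjective r
    refine (hdia r a).trans ?_
    simp [Frame.complexAlgebra, Frame.comap]

theorem IsComplete.of_renameImp (e : R ≃ S) {Ax : Set (Implication R)}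
    (h : IsComplete (renameImp e '' Ax)) : IsComplete Ax := by
  refine fun ι => ⟨fun hK A hA => ?_, SLOConsequence.krConsequence⟩
  refine (SLO.validates_comap_renameImp e A ι).1 ((h (SPi.renameImp e ι)).1 (fun F hF => ?_) _ ?_)
  · rw [Frame.validates_renameImp]
    exact hK _ fun κ hκ => (Frame.validates_renameImp _ _ _).1 (hF _ ⟨κ, hκ, rfl⟩)
  · rintro _ ⟨κ, hκ, rfl⟩
    exact (SLO.validates_comap_renameImp e A κ).2 (hA κ hκ)

/-! ### The filter frame and canonical sp-implications -/

namespace SLO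

/-- Filters of an SLO. -/
structure Flt (A : SLO R) where
  carrier : Set A.carrier
  top_mem : ⊤ ∈ carrier
  inf_mem : ∀ {a b}, a ∈ carrier → b ∈ carrier → a ⊓ b ∈ carrier
  mem_of_le : ∀ {a b}, a ≤ b → a ∈ carrier → b ∈ carrier

instance (A : SLO R) : Membership A.carrier A.Flt := ⟨fun F a => a ∈ F.carrier⟩

/-- The principal filter generated by `a`. -/
def principal (A : SLO R) (a : A.carrier) : A.Flt where
  carrier := Set.Ici a
  top_mem := le_top
  inf_mem := le_inf
  mem_of_le h h' := le_trans h' h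

/-- The frame of all filters of `A`, in which `F` sees `G` if `◇ a ∈ F` for all `a ∈ G`. -/
def filterFrame (A : SLO R) : Frame R where
  World := A.Flt
  nonempty := ⟨A.principal ⊤⟩
  rel r F G := ∀ a ∈ G, A.dia r a ∈ F

end SLO

namespace Formula

/-- The list of the occurrences of variables in an sp-formula. -/
def vars : Formula R → List ℕ
  | var p => [p]
  | top => []
  | and σ τ => σ.vars ++ τ.vars
  | dia _ σ => σ.vars

/-- Every occurrence of a variable is in the scope of a diamond. -/
inductive Guarded : Formula R → Prop
  | top : Guarded top
  | and {σ τ : Formula R} : Guarded σ → Guarded τ → Guarded (and σ τ)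
  | dia_var {r : R} {p : ℕ} : Guarded (dia r (var p))
  | dia {r : R} {σ : Formula R} : Guarded σ → Guarded (dia r σ)

end Formula

namespace SLO

variable (A : SLO R)

/-- Each variable of a linear formula occurs once, so a single filter `K p`, the world at which that
occurrence is evaluated, records all that truth at `F` demands of `p`. -/
theorem exists_filters_of_sat {v : ℕ → Set A.Flt} {σ : Formula R} {F : A.Flt}
    (hσ : σ.vars.Nodup) (h : A.filterFrame.Sat v F σ) :
    ∃ K : ℕ → A.Flt, (∀ p ∈ σ.vars, K p ∈ v p) ∧
      ∀ a : ℕ → A.carrier, (∀ p ∈ σ.vars, a p ∈ K p) → A.value a σ ∈ F := by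
  induction σ generalizing F with
  | var p =>
    exact ⟨fun _ => F, List.forall_mem_singleton.2 h, fun a ha => ha p (List.mem_singleton_self p)⟩
  | top => exact ⟨fun _ => F, by simp [Formula.vars], fun _ _ => F.top_mem⟩
  | and σ τ ih1 ih2 =>
    obtain ⟨n1, n2, hd⟩ := List.nodup_append'.1 hσ
    obtain ⟨K1, hv1, hK1⟩ := ih1 n1 h.1
    obtain ⟨K2, hv2, hK2⟩ := ih2 n2 h.2
    have e2 : ∀ p ∈ τ.vars, p ∉ σ.vars := fun p h2 h1 => hd h1 h2
    refine ⟨fun p => if p ∈ σ.vars then K1 p else K2 p, fun p hp => ?_, fun a ha =>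
      F.inf_mem (hK1 a fun p hp => ?_) (hK2 a fun p hp => ?_)⟩
    · by_cases h1 : p ∈ σ.vars
      · simpa [h1] using hv1 p h1
      · simpa [h1] using hv2 p (by simpa [Formula.vars, h1] using hp)
    · simpa [hp] using ha p (by simp [Formula.vars, hp])
    · simpa [e2 p hp] using ha p (by simp [Formula.vars, hp])
  | dia r σ ih =>
    obtain ⟨G, hFG, hG⟩ := h
    obtain ⟨K, hv, hK⟩ := ih hσ hG
    exact ⟨K, hv, fun a ha => hFG _ (hK a ha)⟩

/-- Guardedness is what lets `K p` be the world for each occurrence of `p`: a diamond above it only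
asks that `F` sees `K p`, whereas an unguarded `p` would ask for `F ∈ v p`. -/
theorem sat_of_forall_mem {v : ℕ → Set A.Flt} {τ : Formula R} (hτ : τ.Guarded) {F : A.Flt}
    {K : ℕ → A.Flt} (hv : ∀ p ∈ τ.vars, K p ∈ v p)
    (h : ∀ a : ℕ → A.carrier, (∀ p, a p ∈ K p) → A.value a τ ∈ F) :
    A.filterFrame.Sat v F τ := by
  induction hτ generalizing F with
  | top => trivial
  | and _ _ ih1 ih2 =>
    exact ⟨ih1 (fun p hp => hv p (List.mem_append_left _ hp))
        fun a ha => F.mem_of_le inf_le_left (h a ha),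
      ih2 (fun p hp => hv p (List.mem_append_right _ hp))
        fun a ha => F.mem_of_le inf_le_right (h a ha)⟩
  | @dia_var r p =>
    refine ⟨K p, fun x hx => ?_, hv p (by simp [Formula.vars])⟩
    -- All variables other than `p` may take the value `⊤`, which lies in every filter.
    have := h (fun q => if q = p then x else ⊤) fun q => by
      split_ifs with hq
      · exact hq ▸ hx
      · exact (K q).top_mem
    simpa [value] using this
  | @dia r σ _ ih =>
    -- The successor is the filter generated by the values of `σ` under valuations drawn from `K`;
    -- it is closed under meets because `σ` is monotone.
    refine ⟨⟨{x | ∃ a : ℕ → A.carrier, (∀ p, a p ∈ K p) ∧ A.value a σ ≤ x},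
      ⟨fun _ => ⊤, fun p => (K p).top_mem, le_top⟩, ?_, ?_⟩, ?_, ih hv fun a ha => ⟨a, ha, le_rfl⟩⟩
    · rintro x y ⟨a, ha, hx⟩ ⟨b, hb, hy⟩
      exact ⟨fun p => a p ⊓ b p, fun p => (K p).inf_mem (ha p) (hb p),
        le_inf ((A.value_mono (fun _ => inf_le_left) σ).trans hx)
          ((A.value_mono (fun _ => inf_le_right) σ).trans hy)⟩
    · rintro x y hxy ⟨a, ha, hx⟩
      exact ⟨a, ha, hx.trans hxy⟩
    · rintro x ⟨a, ha, hx⟩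
      exact F.mem_of_le (A.dia_mono r hx) (h a ha)

/-- Sp-implications with a linear left-hand side and a guarded right-hand side are canonical. -/
theorem filterFrame_validates {ι : Implication R} (hl : ι.1.vars.Nodup) (hg : ι.2.Guarded)
    (hs : ι.2.vars ⊆ ι.1.vars) (h : A.Validates ι) : A.filterFrame.Validates ι := by
  intro v F hF
  obtain ⟨K, hv, hK⟩ := A.exists_filters_of_sat hl hF
  exact A.sat_of_forall_mem hg (fun p hp => hv p (hs hp)) fun a ha =>
    F.mem_of_le (h a) (hK a fun p _ => ha p)

end SLO

/-! ### Encoding machine configurations by sp-formulas -/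

/-- The diamonds used for describing configurations of the machine. -/
inductive Symb : Type
  | halted | norm | ret | fst | snd | thd | nil | head | tail | zero | pred
  | codeZero | codeSucc | codeTail | codeCons | codeComp | codeCase | codeFix
  | contHalt | contCons₁ | contCons₂ | contComp | contFix
  deriving DecidableEq

namespace Symb

instance : Fintype Symb where
  elems := {halted, norm, ret, fst, snd, thd, nil, head, tail, zero, pred,
    codeZero, codeSucc, codeTail, codeCons, codeComp, codeCase, codeFix,
    contHalt, contCons₁, contCons₂, contComp, contFix}
  complete := by rintro ⟨⟩ <;> decide

open Formula

/-- The sp-formula saying that the current node carries the tag `r`. -/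
abbrev tag (r : Symb) : Formula Symb := dia r top

abbrev consF (n l : Formula Symb) : Formula Symb := and (dia head n) (dia tail l)

abbrev tag₁ (r : Symb) (σ : Formula Symb) : Formula Symb := and (tag r) (dia fst σ)

abbrev tag₂ (r : Symb) (σ τ : Formula Symb) : Formula Symb :=
  and (tag r) (and (dia fst σ) (dia snd τ))

abbrev tag₃ (r : Symb) (σ τ ρ : Formula Symb) : Formula Symb :=
  and (tag r) (and (dia fst σ) (and (dia snd τ) (dia thd ρ)))

/-- The configuration evaluating the code `c` at the input `v` with continuation `k`. -/
abbrev normF (c k v : Formula Symb) : Formula Symb :=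
  dia norm (and (dia fst c) (and (dia snd k) (dia thd v)))

/-- The configuration returning the value `v` to the continuation `k`. -/
abbrev retF (k v : Formula Symb) : Formula Symb := dia ret (and (dia snd k) (dia thd v))

/-- The sp-implications describing the steps of the machine. -/
def rules : List (Implication Symb) :=
  let x := var 0
  let y := var 1
  let z := var 2
  let t := var 3
  -- The machine reads the head and tail of the empty list as `0` and `[]`, as `List.headI` and
  -- `List.tail` do.
  [(tag nil, consF (tag zero) (tag nil)),
   (normF (tag codeZero) x y, retF x (consF (tag zero) y)),
   (normF (tag codeSucc) x (consF y z), retF x (consF (dia pred y) (tag nil))),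
   (normF (tag codeTail) x (consF y z), retF x z),
   (normF (tag₂ codeCons x y) z t, normF x (tag₃ contCons₁ y t z) t),
   (normF (tag₂ codeComp x y) z t, normF y (tag₂ contComp x z) t),
   (normF (tag₂ codeCase x y) z (consF (tag zero) t), normF x z t),
   (normF (tag₂ codeCase x y) z (consF (dia pred (var 4)) t), normF y z (consF (var 4) t)),
   (normF (tag₁ codeFix x) z t, normF x (tag₂ contFix x z) t),
   (retF (tag₃ contCons₁ x y z) t, normF x (tag₂ contCons₂ t z) y),
   (retF (tag₂ contCons₂ (consF x y) z) t, retF z (consF x t)),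
   (retF (tag₂ contComp x z) t, normF x z t),
   (retF (tag₂ contFix x z) (consF (tag zero) t), retF z t),
   (retF (tag₂ contFix x z) (consF (dia pred y) t), normF x (tag₂ contFix x z) t),
   (retF (tag contHalt) x, tag halted)]

theorem rules_canonical : ∀ ι ∈ rules, ι.1.vars.Nodup ∧ ι.2.Guarded ∧ ι.2.vars ⊆ ι.1.vars := by
  simp only [rules, List.forall_mem_cons]
  refine ⟨?_, ?_, ?_, ?_, ?_, ?_, ?_, ?_, ?_, ?_, ?_, ?_, ?_, ?_, ?_, by simp⟩ <;>
    exact ⟨by decide, by repeat constructor, by decide⟩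

def natF : ℕ → Formula Symb
  | 0 => tag zero
  | n + 1 => dia pred (natF n)

def listF : List ℕ → Formula Symb
  | [] => tag nil
  | n :: l => consF (natF n) (listF l)

def codeF : Code → Formula Symb
  | .zero' => tag codeZero
  | .succ => tag codeSucc
  | .tail => tag codeTail
  | .cons f g => tag₂ codeCons (codeF f) (codeF g)
  | .comp f g => tag₂ codeComp (codeF f) (codeF g)
  | .case f g => tag₂ codeCase (codeF f) (codeF g)
  | .fix f => tag₁ codeFix (codeF f)

def contF : Cont → Formula Symb
  | .halt => tag contHalt
  | .cons₁ f v k => tag₃ contCons₁ (codeF f) (listF v) (contF k)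
  | .cons₂ v k => tag₂ contCons₂ (listF v) (contF k)
  | .comp f k => tag₂ contComp (codeF f) (contF k)
  | .fix f k => tag₂ contFix (codeF f) (contF k)

/-- The output is forgotten, as only halting matters. `Cfg` has no evaluating state, since
`stepNormal` runs on to the next return; formulas `normF` describe the intermediate stages. -/
def cfgF : Cfg → Formula Symb
  | .halt _ => tag halted
  | .ret k v => retF (contF k) (listF v)

/-- The initial configuration of the code `c` with input `[n]`. -/
def startF (c : Code) (n : ℕ) : Formula Symb := normF (codeF c) (contF .halt) (listF [n])

/-! ### Computations are valid in SLOs for the rules -/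

section

variable {A : SLO Symb} {a : ℕ → A.carrier}

/-- The list `s` gives the formulas substituted for variables 0, 1, …; later variables, and gaps in
the numbering of a rule, are filled by `top`. -/
theorem value_rule_le (h : ∀ ι ∈ rules, A.Validates ι) (s : List (Formula Symb))
    {ι : Implication Symb} (hι : ι ∈ rules) :
    A.value a (ι.1.subst (s.getD · top)) ≤ A.value a (ι.2.subst (s.getD · top)) := by
  simpa only [SLO.value_subst] using h ι hι _

theorem value_listF_le (h : ∀ ι ∈ rules, A.Validates ι) (v : List ℕ) :
    A.value a (listF v) ≤ A.value a (consF (natF v.headI) (listF v.tail)) := by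
  cases v with
  | nil => exact value_rule_le h [] (ι := (tag nil, consF (tag zero) (tag nil))) (by simp [rules])
  | cons n l => exact le_rfl

theorem value_normF_mono (c k : Formula Symb) {v w : Formula Symb}
    (h : A.value a v ≤ A.value a w) : A.value a (normF c k v) ≤ A.value a (normF c k w) :=
  A.dia_mono _ (inf_le_inf le_rfl (inf_le_inf le_rfl (A.dia_mono _ h)))

theorem value_retF_mono {k l v w : Formula Symb} (hk : A.value a k ≤ A.value a l)
    (h : A.value a v ≤ A.value a w) : A.value a (retF k v) ≤ A.value a (retF l w) :=
  A.dia_mono _ (inf_le_inf (A.dia_mono _ hk) (A.dia_mono _ h))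

/-- `stepNormal` is a structural recursion on the code, so one rule followed by the induction
hypothesis handles each constructor; `k` and `v` vary along the way. -/
theorem value_normF_le (h : ∀ ι ∈ rules, A.Validates ι) (c : Code) (k : Cont) (v : List ℕ) :
    A.value a (normF (codeF c) (contF k) (listF v)) ≤ A.value a (cfgF (stepNormal c k v)) := by
  have hv := value_listF_le (a := a) h v
  have hi : ∀ i (hi : i < rules.length), rules[i] ∈ rules := fun i hi => List.getElem_mem hi
  induction c generalizing k v with
  | zero' => exact value_rule_le h [contF k, listF v] (hi 1 (by decide))
  | succ =>
    exact (value_normF_mono _ _ hv).trans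
      (value_rule_le h [contF k, natF v.headI, listF v.tail] (hi 2 (by decide)))
  | tail =>
    exact (value_normF_mono _ _ hv).trans
      (value_rule_le h [contF k, natF v.headI, listF v.tail] (hi 3 (by decide)))
  | cons f g ihf ihg =>
    exact (value_rule_le h [codeF f, codeF g, contF k, listF v] (hi 4 (by decide))).trans
      (ihf (.cons₁ g v k) v hv)
  | comp f g ihf ihg =>
    exact (value_rule_le h [codeF f, codeF g, contF k, listF v] (hi 5 (by decide))).trans
      (ihg (.comp f k) v hv)
  | case f g ihf ihg =>
    refine (value_normF_mono _ _ hv).trans ?_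
    simp only [stepNormal]
    cases v.headI with
    | zero =>
      exact (value_rule_le h [codeF f, codeF g, contF k, listF v.tail] (hi 6 (by decide))).trans
        (ihf k v.tail (value_listF_le h _))
    | succ n =>
      exact (value_rule_le h [codeF f, codeF g, contF k, listF v.tail, natF n]
        (hi 7 (by decide))).trans (ihg k (n :: v.tail) le_rfl)
  | fix f ihf =>
    exact (value_rule_le h [codeF f, top, contF k, listF v] (hi 8 (by decide))).trans
      (ihf (.fix f k) v hv)

/-- Induction on the continuation is needed because `stepRet` may pop several frames at once, in the
`cons₂` case and when a `fix` loop ends. -/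
theorem value_retF_le (h : ∀ ι ∈ rules, A.Validates ι) (k : Cont) (v : List ℕ) :
    A.value a (retF (contF k) (listF v)) ≤ A.value a (cfgF (stepRet k v)) := by
  have hv := value_listF_le (a := a) h v
  have hi : ∀ i (hi : i < rules.length), rules[i] ∈ rules := fun i hi => List.getElem_mem hi
  induction k generalizing v with
  | halt => exact value_rule_le h [listF v] (hi 14 (by decide))
  | cons₁ f w k ih =>
    exact (value_rule_le h [codeF f, listF w, contF k, listF v] (hi 9 (by decide))).trans
      (value_normF_le h f (.cons₂ v k) w)
  | cons₂ w k ih =>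
    refine (value_retF_mono (l := tag₂ contCons₂ (consF (natF w.headI) (listF w.tail)) (contF k))
      ?_ le_rfl).trans ((value_rule_le h [natF w.headI, listF w.tail, contF k, listF v]
        (hi 10 (by decide))).trans (ih (w.headI :: v) le_rfl))
    exact inf_le_inf le_rfl (inf_le_inf (A.dia_mono _ (value_listF_le h w)) le_rfl)
  | comp f k ih =>
    exact (value_rule_le h [codeF f, top, contF k, listF v] (hi 11 (by decide))).trans
      (value_normF_le h f k v)
  | fix f k ih =>
    refine (value_retF_mono le_rfl hv).trans ?_
    simp only [stepRet]
    cases v.headI with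
    | zero =>
      exact (value_rule_le h [codeF f, top, contF k, listF v.tail] (hi 12 (by decide))).trans
        (ih v.tail (value_listF_le h _))
    | succ n =>
      exact (value_rule_le h [codeF f, natF n, contF k, listF v.tail] (hi 13 (by decide))).trans
        (value_normF_le h f (.fix f k) v.tail)

theorem value_startF_le (h : ∀ ι ∈ rules, A.Validates ι) {c : Code} {n : ℕ}
    (hc : (c.eval [n]).Dom) : A.value a (startF c n) ≤ A.value a (tag halted) := by
  refine (value_normF_le h c .halt [n]).trans ?_
  have hd : (StateTransition.eval step (stepNormal c .halt [n])).Dom := by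
    rw [stepNormal_eval]; exact hc
  obtain ⟨b, hb⟩ := Part.dom_iff_mem.1 hd
  refine StateTransition.evalInduction (C := fun s => A.value a (cfgF s) ≤ A.value a (tag halted))
    hb fun s _ ih => ?_
  cases s with
  | halt => exact le_rfl
  | ret k v => exact (value_retF_le h k v).trans (ih _ rfl)

end

/-! ### The frame of non-halting configurations -/

/-- The points of the machine frame. -/
inductive World : Type
  | root
  | norm (c : Code) (k : Cont) (v : List ℕ)
  | ret (k : Cont) (v : List ℕ)
  | code (c : Code)
  | cont (k : Cont)
  | list (v : List ℕ)
  | nat (n : ℕ)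

/-- The machine eventually halts when started in configuration `s`. -/
def Halts (s : Cfg) : Prop := (StateTransition.eval step s).Dom

/-- The relations of the machine frame: the root sees the configurations that never halt,
and these see the data they consist of. -/
inductive Rel : Symb → World → World → Prop
  | norm {c k v} (h : ¬ Halts (stepNormal c k v)) : Rel norm .root (.norm c k v)
  | ret {k v} (h : ¬ Halts (stepRet k v)) : Rel ret .root (.ret k v)
  | normFst {c k v} : Rel fst (.norm c k v) (.code c)
  | normSnd {c k v} : Rel snd (.norm c k v) (.cont k)
  | normThd {c k v} : Rel thd (.norm c k v) (.list v)
  | retSnd {k v} : Rel snd (.ret k v) (.cont k)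
  | retThd {k v} : Rel thd (.ret k v) (.list v)
  | nil {v} (h : v = []) : Rel nil (.list v) (.list v)
  -- The equation is a premise because `v.headI`, not being a constructor term, would obstruct case
  -- analysis as an index.
  | head {v n} (h : v.headI = n) : Rel head (.list v) (.nat n)
  | tail {v w} (h : v.tail = w) : Rel tail (.list v) (.list w)
  | zero {n} (h : n = 0) : Rel zero (.nat n) (.nat n)
  | pred {n m} (h : n = m + 1) : Rel pred (.nat n) (.nat m)
  | codeZero : Rel codeZero (.code .zero') (.code .zero')
  | codeSucc : Rel codeSucc (.code .succ) (.code .succ)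
  | codeTail : Rel codeTail (.code .tail) (.code .tail)
  | codeCons {f g} : Rel codeCons (.code (.cons f g)) (.code (.cons f g))
  | consFst {f g} : Rel fst (.code (.cons f g)) (.code f)
  | consSnd {f g} : Rel snd (.code (.cons f g)) (.code g)
  | codeComp {f g} : Rel codeComp (.code (.comp f g)) (.code (.comp f g))
  | compFst {f g} : Rel fst (.code (.comp f g)) (.code f)
  | compSnd {f g} : Rel snd (.code (.comp f g)) (.code g)
  | codeCase {f g} : Rel codeCase (.code (.case f g)) (.code (.case f g))
  | caseFst {f g} : Rel fst (.code (.case f g)) (.code f)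
  | caseSnd {f g} : Rel snd (.code (.case f g)) (.code g)
  | codeFix {f} : Rel codeFix (.code (.fix f)) (.code (.fix f))
  | fixFst {f} : Rel fst (.code (.fix f)) (.code f)
  | contHalt : Rel contHalt (.cont .halt) (.cont .halt)
  | contCons₁ {f v k} : Rel contCons₁ (.cont (.cons₁ f v k)) (.cont (.cons₁ f v k))
  | cons₁Fst {f v k} : Rel fst (.cont (.cons₁ f v k)) (.code f)
  | cons₁Snd {f v k} : Rel snd (.cont (.cons₁ f v k)) (.list v)
  | cons₁Thd {f v k} : Rel thd (.cont (.cons₁ f v k)) (.cont k)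
  | contCons₂ {v k} : Rel contCons₂ (.cont (.cons₂ v k)) (.cont (.cons₂ v k))
  | cons₂Fst {v k} : Rel fst (.cont (.cons₂ v k)) (.list v)
  | cons₂Snd {v k} : Rel snd (.cont (.cons₂ v k)) (.cont k)
  | contComp {f k} : Rel contComp (.cont (.comp f k)) (.cont (.comp f k))
  | compContFst {f k} : Rel fst (.cont (.comp f k)) (.code f)
  | compContSnd {f k} : Rel snd (.cont (.comp f k)) (.cont k)
  | contFix {f k} : Rel contFix (.cont (.fix f k)) (.cont (.fix f k))
  | fixContFst {f k} : Rel fst (.cont (.fix f k)) (.code f)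
  | fixContSnd {f k} : Rel snd (.cont (.fix f k)) (.cont k)

/-- The frame of non-halting configurations. -/
abbrev machineFrame : Frame Symb where
  World := World
  nonempty := ⟨.root⟩
  rel := Rel

theorem halts_ret {k : Cont} {v : List ℕ} : Halts (.ret k v) ↔ Halts (stepRet k v) := by
  have : StateTransition.eval step (.ret k v) = StateTransition.eval step (stepRet k v) :=
    StateTransition.reaches_eval (Relation.ReflTransGen.single rfl)
  rw [Halts, Halts, this]

theorem halts_halt {v : List ℕ} : Halts (.halt v) :=
  Part.dom_iff_mem.2 ⟨_, StateTransition.mem_eval.2 ⟨.refl, rfl⟩⟩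

theorem sat_natF (v : ℕ → Set World) (n : ℕ) : machineFrame.Sat v (.nat n) (natF n) := by
  induction n with
  | zero => exact ⟨_, .zero rfl, trivial⟩
  | succ n ih => exact ⟨_, .pred rfl, ih⟩

theorem sat_codeF (v : ℕ → Set World) (c : Code) : machineFrame.Sat v (.code c) (codeF c) := by
  induction c with
  | zero' => exact ⟨_, .codeZero, trivial⟩
  | succ => exact ⟨_, .codeSucc, trivial⟩
  | tail => exact ⟨_, .codeTail, trivial⟩
  | cons f g h1 h2 => exact ⟨⟨_, .codeCons, trivial⟩, ⟨_, .consFst, h1⟩, _, .consSnd, h2⟩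
  | comp f g h1 h2 => exact ⟨⟨_, .codeComp, trivial⟩, ⟨_, .compFst, h1⟩, _, .compSnd, h2⟩
  | case f g h1 h2 => exact ⟨⟨_, .codeCase, trivial⟩, ⟨_, .caseFst, h1⟩, _, .caseSnd, h2⟩
  | fix f h1 => exact ⟨⟨_, .codeFix, trivial⟩, _, .fixFst, h1⟩

theorem sat_startF (v : ℕ → Set World) {c : Code} {n : ℕ} (h : ¬ (c.eval [n]).Dom) :
    machineFrame.Sat v .root (startF c n) := by
  have h' : ¬ Halts (stepNormal c .halt [n]) := by
    rw [Halts, stepNormal_eval]; exact h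
  exact ⟨_, .norm h', ⟨_, .normFst, sat_codeF v c⟩, ⟨_, .normSnd, _, .contHalt, trivial⟩, _,
    .normThd, ⟨_, .head rfl, sat_natF v n⟩, _, .tail rfl, _, .nil rfl, trivial⟩

/-! ### Truth conditions of the machine formulas in the machine frame -/

section

variable {v : ℕ → Set World} {σ τ ρ : Formula Symb}

theorem sat_normF {w : World} : machineFrame.Sat v w (normF σ τ ρ) ↔ w = .root ∧
    ∃ c k l, ¬ Halts (stepNormal c k l) ∧ machineFrame.Sat v (.code c) σ ∧
      machineFrame.Sat v (.cont k) τ ∧ machineFrame.Sat v (.list l) ρ := by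
  constructor
  · rintro ⟨_, hw, h'⟩
    cases hw with | norm h =>
    obtain ⟨⟨_, ⟨⟩, hc⟩, ⟨_, ⟨⟩, hk⟩, _, ⟨⟩, hl⟩ := h'
    exact ⟨rfl, _, _, _, h, hc, hk, hl⟩
  · rintro ⟨rfl, c, k, l, h, hc, hk, hl⟩
    exact ⟨_, .norm h, ⟨_, .normFst, hc⟩, ⟨_, .normSnd, hk⟩, _, .normThd, hl⟩

theorem sat_retF {w : World} : machineFrame.Sat v w (retF σ τ) ↔ w = .root ∧
    ∃ k l, ¬ Halts (stepRet k l) ∧ machineFrame.Sat v (.cont k) σ ∧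
      machineFrame.Sat v (.list l) τ := by
  constructor
  · rintro ⟨_, hw, h'⟩
    cases hw with | ret h =>
    obtain ⟨⟨_, ⟨⟩, hk⟩, _, ⟨⟩, hl⟩ := h'
    exact ⟨rfl, _, _, h, hk, hl⟩
  · rintro ⟨rfl, k, l, h, hk, hl⟩
    exact ⟨_, .ret h, ⟨_, .retSnd, hk⟩, _, .retThd, hl⟩

theorem sat_consF {l : List ℕ} : machineFrame.Sat v (.list l) (consF σ τ) ↔
    machineFrame.Sat v (.nat l.headI) σ ∧ machineFrame.Sat v (.list l.tail) τ := by
  constructor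
  · rintro ⟨⟨_, h, hn⟩, _, h', hl⟩
    cases h with | head h =>
    cases h' with | tail h' =>
    subst h h'
    exact ⟨hn, hl⟩
  · exact fun ⟨hn, hl⟩ => ⟨⟨_, .head rfl, hn⟩, _, .tail rfl, hl⟩

theorem sat_nil {w : World} : machineFrame.Sat v w (tag nil) ↔ w = .list [] := by
  constructor
  · rintro ⟨_, h, -⟩
    cases h with | nil h =>
    rw [h]
  · rintro rfl
    exact ⟨_, .nil rfl, trivial⟩

theorem sat_zero {n : ℕ} : machineFrame.Sat v (.nat n) (tag zero) ↔ n = 0 := by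
  constructor
  · rintro ⟨_, h, -⟩
    cases h with | zero h =>
    exact h
  · rintro rfl
    exact ⟨_, .zero rfl, trivial⟩

theorem sat_pred {n : ℕ} : machineFrame.Sat v (.nat n) (dia pred σ) ↔
    ∃ m, n = m + 1 ∧ machineFrame.Sat v (.nat m) σ := by
  constructor
  · rintro ⟨_, h, hm⟩
    cases h with | pred h =>
    exact ⟨_, h, hm⟩
  · rintro ⟨m, h, hm⟩
    exact ⟨_, .pred h, hm⟩

variable {c : Code} {k : Cont}

theorem sat_codeZero : machineFrame.Sat v (.code c) (tag codeZero) ↔ c = .zero' := by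
  constructor
  · rintro ⟨_, ⟨⟩, -⟩
    rfl
  · rintro rfl
    exact ⟨_, .codeZero, trivial⟩

theorem sat_codeSucc : machineFrame.Sat v (.code c) (tag codeSucc) ↔ c = .succ := by
  constructor
  · rintro ⟨_, ⟨⟩, -⟩
    rfl
  · rintro rfl
    exact ⟨_, .codeSucc, trivial⟩

theorem sat_codeTail : machineFrame.Sat v (.code c) (tag codeTail) ↔ c = .tail := by
  constructor
  · rintro ⟨_, ⟨⟩, -⟩
    rfl
  · rintro rfl
    exact ⟨_, .codeTail, trivial⟩

theorem sat_codeCons : machineFrame.Sat v (.code c) (tag₂ codeCons σ τ) ↔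
    ∃ f g, c = .cons f g ∧ machineFrame.Sat v (.code f) σ ∧ machineFrame.Sat v (.code g) τ := by
  constructor
  · rintro ⟨⟨_, ⟨⟩, -⟩, ⟨_, ⟨⟩, hf⟩, _, ⟨⟩, hg⟩
    exact ⟨_, _, rfl, hf, hg⟩
  · rintro ⟨f, g, rfl, hf, hg⟩
    exact ⟨⟨_, .codeCons, trivial⟩, ⟨_, .consFst, hf⟩, _, .consSnd, hg⟩

theorem sat_codeComp : machineFrame.Sat v (.code c) (tag₂ codeComp σ τ) ↔
    ∃ f g, c = .comp f g ∧ machineFrame.Sat v (.code f) σ ∧ machineFrame.Sat v (.code g) τ := by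
  constructor
  · rintro ⟨⟨_, ⟨⟩, -⟩, ⟨_, ⟨⟩, hf⟩, _, ⟨⟩, hg⟩
    exact ⟨_, _, rfl, hf, hg⟩
  · rintro ⟨f, g, rfl, hf, hg⟩
    exact ⟨⟨_, .codeComp, trivial⟩, ⟨_, .compFst, hf⟩, _, .compSnd, hg⟩

theorem sat_codeCase : machineFrame.Sat v (.code c) (tag₂ codeCase σ τ) ↔
    ∃ f g, c = .case f g ∧ machineFrame.Sat v (.code f) σ ∧ machineFrame.Sat v (.code g) τ := by
  constructor
  · rintro ⟨⟨_, ⟨⟩, -⟩, ⟨_, ⟨⟩, hf⟩, _, ⟨⟩, hg⟩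
    exact ⟨_, _, rfl, hf, hg⟩
  · rintro ⟨f, g, rfl, hf, hg⟩
    exact ⟨⟨_, .codeCase, trivial⟩, ⟨_, .caseFst, hf⟩, _, .caseSnd, hg⟩

theorem sat_codeFix : machineFrame.Sat v (.code c) (tag₁ codeFix σ) ↔
    ∃ f, c = .fix f ∧ machineFrame.Sat v (.code f) σ := by
  constructor
  · rintro ⟨⟨_, ⟨⟩, -⟩, _, ⟨⟩, hf⟩
    exact ⟨_, rfl, hf⟩
  · rintro ⟨f, rfl, hf⟩
    exact ⟨⟨_, .codeFix, trivial⟩, _, .fixFst, hf⟩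

theorem sat_contHalt : machineFrame.Sat v (.cont k) (tag contHalt) ↔ k = .halt := by
  constructor
  · rintro ⟨_, ⟨⟩, -⟩
    rfl
  · rintro rfl
    exact ⟨_, .contHalt, trivial⟩

theorem sat_contCons₁ : machineFrame.Sat v (.cont k) (tag₃ contCons₁ σ τ ρ) ↔
    ∃ f l k', k = .cons₁ f l k' ∧ machineFrame.Sat v (.code f) σ ∧
      machineFrame.Sat v (.list l) τ ∧ machineFrame.Sat v (.cont k') ρ := by
  constructor
  · rintro ⟨⟨_, ⟨⟩, -⟩, ⟨_, ⟨⟩, hf⟩, ⟨_, ⟨⟩, hl⟩, _, ⟨⟩, hk⟩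
    exact ⟨_, _, _, rfl, hf, hl, hk⟩
  · rintro ⟨f, l, k', rfl, hf, hl, hk⟩
    exact ⟨⟨_, .contCons₁, trivial⟩, ⟨_, .cons₁Fst, hf⟩, ⟨_, .cons₁Snd, hl⟩, _, .cons₁Thd, hk⟩

theorem sat_contCons₂ : machineFrame.Sat v (.cont k) (tag₂ contCons₂ σ τ) ↔
    ∃ l k', k = .cons₂ l k' ∧ machineFrame.Sat v (.list l) σ ∧
      machineFrame.Sat v (.cont k') τ := by
  constructor
  · rintro ⟨⟨_, ⟨⟩, -⟩, ⟨_, ⟨⟩, hl⟩, _, ⟨⟩, hk⟩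
    exact ⟨_, _, rfl, hl, hk⟩
  · rintro ⟨l, k', rfl, hl, hk⟩
    exact ⟨⟨_, .contCons₂, trivial⟩, ⟨_, .cons₂Fst, hl⟩, _, .cons₂Snd, hk⟩

theorem sat_contComp : machineFrame.Sat v (.cont k) (tag₂ contComp σ τ) ↔
    ∃ f k', k = .comp f k' ∧ machineFrame.Sat v (.code f) σ ∧
      machineFrame.Sat v (.cont k') τ := by
  constructor
  · rintro ⟨⟨_, ⟨⟩, -⟩, ⟨_, ⟨⟩, hf⟩, _, ⟨⟩, hk⟩
    exact ⟨_, _, rfl, hf, hk⟩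
  · rintro ⟨f, k', rfl, hf, hk⟩
    exact ⟨⟨_, .contComp, trivial⟩, ⟨_, .compContFst, hf⟩, _, .compContSnd, hk⟩

theorem sat_contFix : machineFrame.Sat v (.cont k) (tag₂ contFix σ τ) ↔
    ∃ f k', k = .fix f k' ∧ machineFrame.Sat v (.code f) σ ∧
      machineFrame.Sat v (.cont k') τ := by
  constructor
  · rintro ⟨⟨_, ⟨⟩, -⟩, ⟨_, ⟨⟩, hf⟩, _, ⟨⟩, hk⟩
    exact ⟨_, _, rfl, hf, hk⟩
  · rintro ⟨f, k', rfl, hf, hk⟩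
    exact ⟨⟨_, .contFix, trivial⟩, ⟨_, .fixContFst, hf⟩, _, .fixContSnd, hk⟩

end

/-- A configuration rule copies one unfolding of `stepNormal` or `stepRet`, so non-halting passes
from its left side to its right side. The last rule holds vacuously, since returning to the halting
continuation halts. -/
theorem machineFrame_validates_rules : ∀ ι ∈ rules, machineFrame.Validates ι := by
  simp only [rules, List.forall_mem_cons]
  refine ⟨?_, ?_, ?_, ?_, ?_, ?_, ?_, ?_, ?_, ?_, ?_, ?_, ?_, ?_, ?_, by simp⟩ <;>
    intro v w <;>
    simp only [sat_normF, sat_retF, sat_consF, sat_nil, sat_zero, sat_pred, sat_codeZero,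
      sat_codeSucc, sat_codeTail, sat_codeCons, sat_codeComp, sat_codeCase, sat_codeFix,
      sat_contHalt, sat_contCons₁, sat_contCons₂, sat_contComp, sat_contFix]
  · rintro rfl
    exact sat_consF.2 ⟨sat_zero.2 rfl, sat_nil.2 rfl⟩
  · rintro ⟨rfl, _, k, l, h, rfl, hk, hl⟩
    -- Here `stepNormal` stops at a return state, while `ret` edges are defined through `stepRet`;
    -- `halts_ret` bridges this one step.
    exact ⟨rfl, k, 0 :: l, mt halts_ret.2 h, hk, rfl, hl⟩
  · rintro ⟨rfl, _, k, l, h, rfl, hk, hn, -⟩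
    exact ⟨rfl, k, [l.headI + 1], mt halts_ret.2 h, hk, ⟨_, rfl, hn⟩, rfl⟩
  · rintro ⟨rfl, _, k, l, h, rfl, hk, -, hl⟩
    exact ⟨rfl, k, l.tail, mt halts_ret.2 h, hk, hl⟩
  · rintro ⟨rfl, _, k, l, h, ⟨f, g, rfl, hf, hg⟩, hk, hl⟩
    exact ⟨rfl, f, .cons₁ g l k, l, h, hf, ⟨g, l, k, rfl, hg, hl, hk⟩, hl⟩
  · rintro ⟨rfl, _, k, l, h, ⟨f, g, rfl, hf, hg⟩, hk, hl⟩
    exact ⟨rfl, g, .comp f k, l, h, hg, ⟨f, k, rfl, hf, hk⟩, hl⟩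
  · rintro ⟨rfl, _, k, l, h, ⟨f, g, rfl, hf, hg⟩, hk, h0, hl⟩
    simp only [stepNormal, h0] at h
    exact ⟨rfl, f, k, l.tail, h, hf, hk, hl⟩
  · rintro ⟨rfl, _, k, l, h, ⟨f, g, rfl, hf, hg⟩, hk, ⟨m, hm, hn⟩, hl⟩
    simp only [stepNormal, hm] at h
    exact ⟨rfl, g, k, m :: l.tail, h, hg, hk, hn, hl⟩
  · rintro ⟨rfl, _, k, l, h, ⟨f, rfl, hf⟩, hk, hl⟩
    exact ⟨rfl, f, .fix f k, l, h, hf, ⟨f, k, rfl, hf, hk⟩, hl⟩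
  · rintro ⟨rfl, _, l, h, ⟨f, l', k, rfl, hf, hl', hk⟩, hl⟩
    exact ⟨rfl, f, .cons₂ l k, l', h, hf, ⟨l, k, rfl, hl, hk⟩, hl'⟩
  · rintro ⟨rfl, _, l, h, ⟨l', k, rfl, ⟨hn, -⟩, hk⟩, hl⟩
    exact ⟨rfl, k, l'.headI :: l, h, hk, hn, hl⟩
  · rintro ⟨rfl, _, l, h, ⟨f, k, rfl, hf, hk⟩, hl⟩
    exact ⟨rfl, f, k, l, h, hf, hk, hl⟩
  · rintro ⟨rfl, _, l, h, ⟨f, k, rfl, hf, hk⟩, h0, hl⟩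
    rw [stepRet, if_pos h0] at h
    exact ⟨rfl, k, l.tail, h, hk, hl⟩
  · rintro ⟨rfl, _, l, h, ⟨f, k, rfl, hf, hk⟩, ⟨m, hm, hn⟩, hl⟩
    rw [stepRet, if_neg (by simp [hm])] at h
    exact ⟨rfl, f, .fix f k, l.tail, h, hf, ⟨f, k, rfl, hf, hk⟩, hl⟩
  · rintro ⟨rfl, _, l, h, rfl, hl⟩
    exact absurd halts_halt h

end Symb

/-! ### The axiomatisation associated with a machine and an input -/

open Formula Symb

/-- The axioms: the rules of the machine, and three sp-implications for an additional diamond,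
which becomes expressible by `p ∧ ◇⊤` precisely when the machine halts. -/
def haltingAxioms (c : Code) (n : ℕ) : List (Implication (Option Symb)) :=
  (dia none top, (startF c n).rename some) :: (dia none (var 0), var 0) ::
    ((var 0).and (dia (some halted) top), dia none (var 0)) :: rules.map (renameImp some)

section

variable {c : Code} {n : ℕ}

theorem forall_mem_haltingAxioms {P : Implication (Option Symb) → Prop} :
    (∀ κ ∈ {ι | ι ∈ haltingAxioms c n}, P κ) ↔ P (dia none top, (startF c n).rename some) ∧
      P (dia none (var 0), var 0) ∧ P ((var 0).and (dia (some halted) top), dia none (var 0)) ∧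
      ∀ κ ∈ rules, P (renameImp some κ) := by
  simp only [Set.mem_ofPred_eq, haltingAxioms, List.forall_mem_cons, List.forall_mem_map]

theorem guarded_natF (n : ℕ) : (natF n).Guarded := by
  induction n with
  | zero => repeat constructor
  | succ n ih => exact .dia ih

theorem guarded_codeF (c : Code) : (codeF c).Guarded := by
  induction c with
  | zero' | succ | tail => repeat constructor
  | cons f g h1 h2 | comp f g h1 h2 | case f g h1 h2 =>
    exact .and (.dia .top) (.and (.dia h1) (.dia h2))
  | fix f h => exact .and (.dia .top) (.dia h)

theorem guarded_startF (c : Code) (n : ℕ) : (startF c n).Guarded :=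
  .dia (.and (.dia (guarded_codeF c)) (.and (.dia (.dia .top))
    (.dia (.and (.dia (guarded_natF n)) (.dia (.dia .top))))))

theorem vars_startF (c : Code) (n : ℕ) : (startF c n).vars = [] := by
  have h1 : (natF n).vars = [] := by induction n <;> simp_all [natF, vars]
  have h2 : (codeF c).vars = [] := by induction c <;> simp_all [codeF, vars]
  simp [startF, vars, contF, listF, h1, h2]

/-- The filter frame of the reduct of `A` to `Symb`, where the additional diamond is interpreted
by the identity relation on the filters containing `◇⊤`. -/
def haltingFrame (A : SLO (Option Symb)) : Frame (Option Symb) where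
  World := (A.comap some).Flt
  nonempty := (A.comap some).filterFrame.nonempty
  rel
    | none, F, G => F = G ∧ A.dia none ⊤ ∈ F
    | some r, F, G => (A.comap some).filterFrame.rel r F G

/-- Halting yields `hh`, which turns the third axiom into x ∧ ◇⊤ ≤ ◇x, so ◇ is determined by ◇⊤. -/
theorem isComplex_haltingAxioms (h : (c.eval [n]).Dom) :
    IsComplex {ι | ι ∈ haltingAxioms c n} := by
  refine isComplex_iff.2 fun A hA => ?_
  obtain ⟨h1, h2, h3, h4⟩ := forall_mem_haltingAxioms.1 hA
  simp only [SLO.validates_renameImp] at h4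
  have hs : A.dia none ⊤ ≤ (A.comap some).value (fun _ => ⊤) (startF c n) :=
    (h1 fun _ => ⊤).trans_eq (SLO.value_rename some A _ _)
  have hh : A.dia none ⊤ ≤ A.dia (some halted) ⊤ := hs.trans (value_startF_le h4 h)
  have hle : ∀ x, A.dia none x ≤ x := fun x => h2 fun _ => x
  have hge : ∀ x, x ⊓ A.dia (some halted) ⊤ ≤ A.dia none x := fun x => h3 fun _ => x
  refine ⟨haltingFrame A, forall_mem_haltingAxioms.2 ⟨?_, ?_, ?_, fun κ hκ => ?_⟩,
    fun x => {F : (A.comap some).Flt | x ∈ F.carrier}, ?_, ?_, ?_, ?_⟩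
  · rintro v (F : (A.comap some).Flt) ⟨_, ⟨rfl, hF⟩, _⟩
    refine ((haltingFrame A).sat_rename some v F _).2 ((A.comap some).sat_of_forall_mem
      (guarded_startF c n) (K := fun _ => (A.comap some).principal ⊤) (by simp [vars_startF])
      fun a ha => ?_)
    -- The start formula has no variables, so `K` is arbitrary; the filter {⊤} leaves only the
    -- constant valuation.
    obtain rfl : a = fun _ => ⊤ := funext fun p => top_le_iff.1 (ha p)
    exact F.mem_of_le hs hF
  · rintro v F ⟨_, ⟨rfl, _⟩, hF⟩
    exact hF
  · rintro v (F : (A.comap some).Flt) ⟨hF, G, hG, _⟩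
    have hG' : A.dia (some halted) ⊤ ∈ F.carrier := hG ⊤ (SLO.Flt.top_mem G)
    exact ⟨F, ⟨rfl, F.mem_of_le ((le_inf le_top le_rfl).trans (hge ⊤)) hG'⟩, hF⟩
  · obtain ⟨hl, hg, hs⟩ := rules_canonical κ hκ
    exact (Frame.validates_renameImp _ _ _).2
      ((A.comap some).filterFrame_validates hl hg hs (h4 κ hκ))
  -- Principal filters separate elements.
  · intro x y hxy
    have h1 : y ≤ x := (Set.ext_iff.1 hxy ((A.comap some).principal y)).2 le_rfl
    have h2 : x ≤ y := (Set.ext_iff.1 hxy ((A.comap some).principal x)).1 le_rfl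
    exact le_antisymm h2 h1
  · exact fun x y => Set.ext fun F => ⟨fun h => ⟨F.mem_of_le inf_le_left h,
      F.mem_of_le inf_le_right h⟩, fun h => F.inf_mem h.1 h.2⟩
  · exact Set.eq_univ_of_forall fun F => F.top_mem
  · rintro (_ | r) x <;> refine Set.ext fun (F : (A.comap some).Flt) => ?_
    · refine ⟨fun h => ⟨F, F.mem_of_le (hle x) h, rfl, F.mem_of_le (A.dia_mono _ le_top) h⟩, ?_⟩
      rintro ⟨_, hx, rfl, hF⟩
      exact F.mem_of_le ((inf_le_inf le_rfl hh).trans (hge x)) (F.inf_mem hx hF)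
    · exact ⟨fun h => ⟨(A.comap some).principal x, le_rfl, fun y hy =>
        F.mem_of_le (A.dia_mono _ hy) h⟩, fun ⟨G, hx, hG⟩ => hG x hx⟩

open Classical in
/-- The complex algebra of the machine frame, with an additional diamond not given by a
relation. -/
noncomputable def machineAlgebra : SLO (Option Symb) where
  carrier := Set World
  dia
    | none, X => if X = Set.univ then {World.root} else ∅
    | some r, X => machineFrame.complexAlgebra.dia r X
  dia_mono
    | none => fun X Y h => by
      by_cases hX : X = Set.univ
      · have hY : Y = Set.univ := Set.univ_subset_iff.1 (hX ▸ h)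
        simp [hX, hY]
      · simp [hX]
    | some r => machineFrame.complexAlgebra.dia_mono r

theorem not_isComplete_haltingAxioms (h : ¬ (c.eval [n]).Dom) :
    ¬ IsComplete {ι | ι ∈ haltingAxioms c n} := by
  intro hc
  have hK : KrConsequence {ι | ι ∈ haltingAxioms c n}
      ((var 0).and (dia none top), dia none (var 0)) := by
    rintro F hF v w ⟨hw, x, hwx, -⟩
    -- Making p true only at the successor `x` turns ◇p → p into `w = x`.
    have := (forall_mem_haltingAxioms.1 hF).2.1 (fun _ => {x}) w ⟨x, hwx, rfl⟩
    obtain rfl : w = x := this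
    exact ⟨w, hwx, hw⟩
  have dia_univ : machineAlgebra.dia none (Set.univ : Set World) = ({World.root} : Set World) :=
    if_pos rfl
  have dia_ne {X : Set World} (hX : X ≠ Set.univ) :
      machineAlgebra.dia none X = (∅ : Set World) := if_neg hX
  have hne : ({World.root} : Set World) ≠ Set.univ := fun h =>
    World.noConfusion (h ▸ Set.mem_univ (World.nat 0) : World.nat 0 ∈ ({World.root} : Set World))
  have := (hc _).1 hK machineAlgebra (forall_mem_haltingAxioms.2 ⟨fun a => ?_, fun a => ?_,
    fun a => ?_, fun κ hκ => ?_⟩) fun _ => ({World.root} : Set World)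
  · have h1 : ({World.root} : Set World) ⊓ machineAlgebra.dia none (Set.univ : Set World) ≤
      machineAlgebra.dia none ({World.root} : Set World) := this
    rw [dia_univ, dia_ne hne] at h1
    exact h1 ⟨rfl, rfl⟩
  · have e : machineAlgebra.value a ((startF c n).rename some) =
        ({w | machineFrame.Sat a w (startF c n)} : Set World) :=
      (SLO.value_rename some machineAlgebra a _).trans (machineFrame.value_complexAlgebra a _)
    exact dia_univ.trans_le (Set.singleton_subset_iff.2 (e.ge (sat_startF a h)))
  · by_cases ha : a 0 = (Set.univ : Set World)
    · exact (Set.subset_univ _).trans ha.ge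
    · exact (dia_ne ha).trans_le (Set.empty_subset _)
  · rintro x ⟨-, y, -, hy⟩
    -- No constructor of `Rel` produces a `halted` edge.
    cases hy
  · exact (SLO.validates_renameImp _ _ _).2
      ((Frame.validates_complexAlgebra _ _).2 (machineFrame_validates_rules κ hκ))

end

/-! ### Computability -/

theorem primrec_dia (r : ℕ) : Primrec (dia r : Formula ℕ → Formula ℕ) :=
  Primrec.encode_iff.1 <| Primrec.nat_add.comp (Primrec.nat_mul.comp (Primrec.const 3)
    (Primrec₂.natPair.comp (Primrec.const r) Primrec.encode)) (Primrec.const 2)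

theorem primrec_and : Primrec₂ (and : Formula ℕ → Formula ℕ → Formula ℕ) :=
  Primrec.encode_iff.1 <| Primrec.nat_add.comp (Primrec.nat_mul.comp (Primrec.const 3)
    (Primrec₂.natPair.comp (Primrec.encode.comp Primrec.fst) (Primrec.encode.comp Primrec.snd)))
    (Primrec.const 3)

theorem primrec_rename_natF (g : Symb → ℕ) : Primrec fun n => (natF n).rename g := by
  refine (Primrec.nat_rec₁ ((natF 0).rename g)
    ((primrec_dia (g pred)).comp Primrec.snd : Primrec fun p : ℕ × Formula ℕ => _).to₂).of_eq
    fun n => ?_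
  induction n with
  | zero => rfl
  | succ n ih => exact congrArg (dia (g pred)) ih

theorem primrec_rename_startF (g : Symb → ℕ) (c : Code) :
    Primrec fun n => (startF c n).rename g :=
  (primrec_dia (g norm)).comp <| primrec_and.comp (Primrec.const ((dia fst (codeF c)).rename g)) <|
    primrec_and.comp (Primrec.const ((dia snd (contF .halt)).rename g)) <|
    (primrec_dia (g thd)).comp <| primrec_and.comp
      ((primrec_dia (g head)).comp (primrec_rename_natF g))
      (Primrec.const ((dia tail (listF [])).rename g))

theorem Formula.rename_rename {T : Type} (f : R → S) (g : S → T) (σ : Formula R) :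
    (σ.rename f).rename g = σ.rename (g ∘ f) := by
  induction σ <;> simp_all [Formula.rename]

/-- A numbering of the signature of `haltingAxioms`. -/
noncomputable def symbEquiv : Option Symb ≃ Fin (Fintype.card Symb + 1) :=
  Fintype.equivFinOfCardEq (by simp)

/-- The finite axiomatisation by `haltingAxioms`. -/
noncomputable def haltingFinAx (c : Code) (n : ℕ) : FinAx :=
  ⟨Fintype.card Symb, (haltingAxioms c n).map (renameImp symbEquiv)⟩

theorem toSet_haltingFinAx (c : Code) (n : ℕ) :
    (haltingFinAx c n).toSet = renameImp symbEquiv '' {ι | ι ∈ haltingAxioms c n} := by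
  ext ι
  exact List.mem_map

/-- Only the first axiom depends on `n`, so the others are constants, taken at input 0. The
numbering of symbols is fixed once and finite, so choosing it noncomputably does no harm. -/
theorem primrec_data_haltingFinAx (c : Code) : Primrec fun n => (haltingFinAx c n).data := by
  have h := primrec_rename_startF (Fin.val ∘ symbEquiv ∘ some) c
  refine (Primrec.pair (Primrec.const (Fintype.card Symb)) (Primrec.list_cons.comp (Primrec.pair
    (Primrec.const ((dia none top).rename (Fin.val ∘ symbEquiv))) h)
    (Primrec.const ((haltingAxioms c 0).tail.map (renameImp (Fin.val ∘ symbEquiv)))))).of_eq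
    fun n => ?_
  simp [FinAx.data, haltingFinAx, haltingAxioms, renameImp, Formula.rename_rename,
    Function.comp_def]

/-! ### Correctness of the reduction, and undecidability -/

theorem halts_iff_isComplex (c : Code) (n : ℕ) :
    (c.eval [n]).Dom ↔ IsComplex (haltingFinAx c n).toSet := by
  rw [toSet_haltingFinAx]
  refine ⟨fun h => (isComplex_haltingAxioms h).renameImp _, fun h => ?_⟩
  by_contra hc
  exact not_isComplete_haltingAxioms hc (h.isComplete.of_renameImp _)

theorem halts_iff_isComplete (c : Code) (n : ℕ) :
    (c.eval [n]).Dom ↔ IsComplete (haltingFinAx c n).toSet := by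
  refine ⟨fun h => ((halts_iff_isComplex c n).1 h).isComplete, fun h => ?_⟩
  rw [toSet_haltingFinAx] at h
  by_contra hc
  exact not_isComplete_haltingAxioms hc (h.of_renameImp _)

/-- A universal machine for the halting problem at input `0`. -/
theorem exists_universal_code :
    ∃ U : Code, ∀ c : Nat.Partrec.Code, (U.eval [Encodable.encode c]).Dom ↔ (c.eval 0).Dom := by
  have hp : Partrec fun n : ℕ => Nat.Partrec.Code.eval (Denumerable.ofNat _ n) 0 :=
    Nat.Partrec.Code.eval_part.comp (Computable.ofNat _) (Computable.const 0)
  obtain ⟨U, hU⟩ := Code.exists_code (Nat.Partrec'.part_iff₁.2 hp)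
  refine ⟨U, fun c => ?_⟩
  have := hU ⟨[Encodable.encode c], rfl⟩
  rw [show U.eval [Encodable.encode c] = _ from this]
  simp [List.Vector.head]

theorem not_isDecidable_of_reduction {P : FinAx → Prop} {f : Nat.Partrec.Code → FinAx}
    (hf : Computable fun c => (f c).data) (h : ∀ c, (c.eval 0).Dom ↔ P (f c)) :
    ¬ IsDecidable P := by
  rintro ⟨d, hd, hdP⟩
  refine ComputablePred.halting_problem 0 (ComputablePred.computable_iff.2
    ⟨fun c => d (f c).data, hd.comp hf, funext fun c => propext ?_⟩)
  rw [h, hdP]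

end SPi

theorem theorem7p1 :
    ¬ SPi.IsDecidable (fun S : SPi.FinAx => SPi.IsComplete S.toSet) ∧
    ¬ SPi.IsDecidable (fun S : SPi.FinAx => SPi.IsComplex S.toSet) ∧
    -- one computable map reduces the halting problem to both problems
    ∃ f : Nat.Partrec.Code → SPi.FinAx,
      Computable (fun c => (f c).data) ∧
      ∀ c : Nat.Partrec.Code,
        ((c.eval 0).Dom ↔ SPi.IsComplex (f c).toSet) ∧
        ((c.eval 0).Dom ↔ SPi.IsComplete (f c).toSet) := by
  -- With `U` fixed, the signature and rules are the same for all programs; a program enters only as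
  -- the numeral in the start formula.
  obtain ⟨U, hU⟩ := SPi.exists_universal_code
  have hf : Computable fun c : Nat.Partrec.Code =>
      (SPi.haltingFinAx U (Encodable.encode c)).data :=
    ((SPi.primrec_data_haltingFinAx U).comp Primrec.encode).to_comp
  have h1 (c : Nat.Partrec.Code) := (hU c).symm.trans (SPi.halts_iff_isComplex U _)
  have h2 (c : Nat.Partrec.Code) := (hU c).symm.trans (SPi.halts_iff_isComplete U _)
  exact ⟨SPi.not_isDecidable_of_reduction hf h2, SPi.not_isDecidable_of_reduction hf h1,
    _, hf, fun c => ⟨h1 c, h2 c⟩⟩
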